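/- **Setting.** $Ty_n$ is classical higher-order logic (Church–Henkin style simple type theory, axiomatized as Andrews' system $Q_0$) with truth type $t$, individual types $e_1,\dots,e_n$, function types $\alpha\beta$ (from $\alpha$ to $\beta$), product types $\alpha\times\beta$ with pairs and projections, arbitrary non-logical constants, and at every type $\alpha$ a description operator $\iota_{(\alpha t)\alpha}$ satisfying $\vdash\iota\,\lambda x_\alpha(y_\alpha=x_\alpha)=y_\alpha$. At a product type $\beta\times\gamma$, $\iota$ denotes below the operator $\lambda z\,\bigl(\iota\,\lambda x_\beta\exists x_\gamma\, z(x_\beta,x_\gamma),\ \iota\,\lambda x_\gamma\exists x_\beta\, z(x_\beta,x_\gamma)\bigr)$, recursively. Let $\mathcal A=\{a_1,\dots,a_N\}$ be a finite alphabet and write $s=e_n$. $Ty_n^{\mathcal A}$ is $Ty_n$ with constants $C^0_s,C^1_s,\dots,C^N_s$ and a binary operation $+$ on $s$ (a constant of type $sss$), and the axioms that $+$ is associative with two-sided unit $C^0_s$ and that $x+C^i_s+y\neq x+C^j_s+z$ for all $x,y,z$ of type $s$ and $1\le i<j\le N$. For a word $w\in\mathcal A^*$ let $/w/$ be the term $C^0_s$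 if $w$ is empty and $C^{i_1}_s+(\dots+C^{i_k}_s)$ if $w=a_{i_1}\cdots a_{i_k}$. $Ty_n^{\mathcal A+}$ is an extension of $Ty_n^{\mathcal A}$ by additional non-logical constants (without axioms), and $\vdash$ is provability in it; in $\Delta\vdash A$ the free variables of the hypotheses $\Delta$ are kept fixed. An $\alpha$-language $\mathcal L$ is a set of pairs $(w,A_\alpha)$ of a word and an $\alpha$-term of $Ty_n^{\mathcal A}$. A word $w$ is *valid* in $\mathcal L$ if $(w,A_\alpha)\in\mathcal L$ for some $A_\alpha$ (otherwise *invalid*), and *ambiguous* if $(w,B_\alpha),(w,C_\alpha)\in\mathcal L$ for some $B_\alpha,C_\alpha$ with $\nvdash B_\alpha=C_\alpha$. Let $\Delta$ be a set of $Ty_n^{\mathcal A+}$ formulas and $L_{s\alpha t}$ a $Ty_n^{\mathcal A+}$ term. $(\Delta,L_{s\alpha t})$ is a *pseudo-canonic representation* of $\mathcal L$ if 1. $\Delta$ is consistent and, for all $w\in\mathcal A^*$ and all $Ty_n^{\mathcal A}$ terms $A_\alpha$: $(w,A_\alpha)\in\mathcal L\iff\Delta\vdash L_{s\alpha t}\,/w/\,A_\alpha$;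 2. for every $w\in\mathcal A^*$ there are finitely many (possibly no) $Ty_n^{\mathcal A}$ terms $A^1_\alpha,\dots,A^l_\alpha$ with $\Delta\vdash L_{s\alpha t}\,/w/=\lambda x_\alpha(x_\alpha=A^1_\alpha\vee\dots\vee x_\alpha=A^l_\alpha)$, where the $x_\alpha$ is not free in the $A^i_\alpha$ and the empty disjunction is the false value; 3. $\Delta$ is conservative over $Ty_n^{\mathcal A}$: for every $Ty_n^{\mathcal A}$ formula $A_t$, $\vdash A_t\iff\Delta\vdash A_t$. The translation operator is $\tau=\lambda x_{s\alpha t}\lambda x_s\,\bigl(\iota_{(\alpha t)\alpha}(x_{s\alpha t}\,x_s)\bigr)$, and the self-extension of $L_{s\alpha t}$ is $$L^+_{s\alpha t}=\lambda x_s\lambda x_\alpha\bigl(L_{s\alpha t}\,x_s\,x_\alpha\ \vee\ x_\alpha=\tau\,L_{s\alpha t}\,x_s\bigr)$$ ($x_s,x_\alpha$ not free in $L_{s\alpha t}$). **Proposition 10.1.** Let $(\Delta,L_{s\alpha t})$ be a pseudo-canonic representation of an $\alpha$-language $\mathcal L$, and let $w\in\mathcal A^*$ be either a valid and non-ambiguous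 expression of $\mathcal L$ or an invalid one. Then $$\Delta\vdash \tau\,L^+_{s\alpha t}\,/w/=\tau\,L_{s\alpha t}\,/w/ .$$ -/

import Mathlib

namespace UHOG

universe u v

/-! ### Types -/

/-- Types of the sorted type theory `Ty_n`: the truth type `t`, the individual types `e_1, …, e_n`
(`ind i`, `i : Fin n`), functional types (from `α` to `β`) and product types. -/
inductive Ty (n : ℕ) : Type
  | t : Ty n
  | ind (i : Fin n) : Ty n
  | fn (α β : Ty n) : Ty n
  | prod (α β : Ty n) : Ty n

infixr:65 " ⇒ " => Ty.fn

/-- The symbolic type `s`, i.e. the last individual type `e_n`. -/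
abbrev Ty.sym {n : ℕ} [NeZero n] : Ty n :=
  Ty.ind ⟨n - 1, Nat.sub_one_lt (NeZero.ne n)⟩

/-! ### Terms

Free variables are named: `fvar α i` is the variable `x^i_α`.  Bound variables are well-typed
de Bruijn indices, so terms are identified up to renaming of bound variables.  `Term N K Γ α` are
the terms of type `α` whose dangling indices are listed in `Γ`; the terms of type `α` of the
theory are the elements of `Term N K [] α`. -/

/-- Non-logical constants of `Ty_n^𝒜` for an alphabet of `N` letters: the empty symbol `C^0_s`, the
letters `C^1_s, …, C^N_s`, the concatenation `C^0_{sss}` and other constants, given by `K`. -/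
inductive Const {n : ℕ} [NeZero n] (N : ℕ) (K : Ty n → Type u) : Ty n → Type u
  | eps : Const N K Ty.sym
  | letter (i : Fin N) : Const N K Ty.sym
  | concat : Const N K (Ty.sym ⇒ Ty.sym ⇒ Ty.sym)
  | other {α : Ty n} (c : K α) : Const N K α

/-- Well-typed de Bruijn indices. -/
inductive Var {n : ℕ} : List (Ty n) → Ty n → Type
  | zero {Γ : List (Ty n)} {α : Ty n} : Var (α :: Γ) α
  | succ {Γ : List (Ty n)} {α β : Ty n} (x : Var Γ α) : Var (β :: Γ) α

/-- Terms; `iota α` is the primitive description operator of type `(αt)α`. -/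
inductive Term {n : ℕ} [NeZero n] (N : ℕ) (K : Ty n → Type u) : List (Ty n) → Ty n → Type u
  | fvar {Γ : List (Ty n)} (α : Ty n) (i : ℕ) : Term N K Γ α
  | bvar {Γ : List (Ty n)} {α : Ty n} (x : Var Γ α) : Term N K Γ α
  | const {Γ : List (Ty n)} {α : Ty n} (c : Const N K α) : Term N K Γ α
  | iota {Γ : List (Ty n)} (α : Ty n) : Term N K Γ ((α ⇒ Ty.t) ⇒ α)
  | app {Γ : List (Ty n)} {α β : Ty n} (A : Term N K Γ (α ⇒ β)) (B : Term N K Γ α) : Term N K Γ β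
  | lam {Γ : List (Ty n)} {α β : Ty n} (A : Term N K (α :: Γ) β) : Term N K Γ (α ⇒ β)
  | eq {Γ : List (Ty n)} {α : Ty n} (A B : Term N K Γ α) : Term N K Γ Ty.t
  | pair {Γ : List (Ty n)} {α β : Ty n} (A : Term N K Γ α) (B : Term N K Γ β) :
      Term N K Γ (Ty.prod α β)
  | fst {Γ : List (Ty n)} {α β : Ty n} (A : Term N K Γ (Ty.prod α β)) : Term N K Γ α
  | snd {Γ : List (Ty n)} {α β : Ty n} (A : Term N K Γ (Ty.prod α β)) : Term N K Γ β

variable {n : ℕ}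

/-! ### Renaming and (capture-avoiding) substitution of de Bruijn indices -/

/-- Renamings. -/
abbrev Ren (Γ Γ' : List (Ty n)) : Type := ∀ α : Ty n, Var Γ α → Var Γ' α

/-- Extension of a renaming under a binder. -/
def Ren.lift {Γ Γ' : List (Ty n)} (r : Ren Γ Γ') (β : Ty n) : Ren (β :: Γ) (β :: Γ')
  | _, Var.zero => Var.zero
  | _, Var.succ x => Var.succ (r _ x)

variable [NeZero n] {N : ℕ} {K : Ty n → Type u} {K' : Ty n → Type v}

/-- Action of a renaming on a term. -/
def Term.rename {Γ : List (Ty n)} {α : Ty n} :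
    Term N K Γ α → ∀ {Γ' : List (Ty n)}, Ren Γ Γ' → Term N K Γ' α
  | .fvar α i, _, _ => .fvar α i
  | .bvar x, _, r => .bvar (r _ x)
  | .const c, _, _ => .const c
  | .iota α, _, _ => .iota α
  | .app A B, _, r => .app (A.rename r) (B.rename r)
  | .lam A, _, r => .lam (A.rename (r.lift _))
  | .eq A B, _, r => .eq (A.rename r) (B.rename r)
  | .pair A B, _, r => .pair (A.rename r) (B.rename r)
  | .fst A, _, r => .fst (A.rename r)
  | .snd A, _, r => .snd (A.rename r)

/-- Weakening: `A` seen under one more binder, which it does not use. -/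
def Term.shift {Γ : List (Ty n)} {α : Ty n} (β : Ty n) (A : Term N K Γ α) : Term N K (β :: Γ) α :=
  A.rename (fun _ x => Var.succ x)

/-- Simultaneous substitutions. -/
abbrev Sub (N : ℕ) (K : Ty n → Type u) (Γ Γ' : List (Ty n)) : Type u :=
  ∀ α : Ty n, Var Γ α → Term N K Γ' α

/-- Extension of a substitution under a binder. -/
def Sub.lift {Γ Γ' : List (Ty n)} (σ : Sub N K Γ Γ') (β : Ty n) : Sub N K (β :: Γ) (β :: Γ')
  | _, Var.zero => .bvar Var.zero
  | _, Var.succ x => (σ _ x).shift β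

/-- Action of a substitution on a term. -/
def Term.subst {Γ : List (Ty n)} {α : Ty n} :
    Term N K Γ α → ∀ {Γ' : List (Ty n)}, Sub N K Γ Γ' → Term N K Γ' α
  | .fvar α i, _, _ => .fvar α i
  | .bvar x, _, σ => σ _ x
  | .const c, _, _ => .const c
  | .iota α, _, _ => .iota α
  | .app A B, _, σ => .app (A.subst σ) (B.subst σ)
  | .lam A, _, σ => .lam (A.subst (σ.lift _))
  | .eq A B, _, σ => .eq (A.subst σ) (B.subst σ)
  | .pair A B, _, σ => .pair (A.subst σ) (B.subst σ)
  | .fst A, _, σ => .fst (A.subst σ)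
  | .snd A, _, σ => .snd (A.subst σ)

/-- The substitution replacing index `0` by `B`. -/
def Sub.single {Γ : List (Ty n)} {β : Ty n} (B : Term N K Γ β) : Sub N K (β :: Γ) Γ
  | _, Var.zero => B
  | _, Var.succ x => .bvar x

/-- `A.inst B` is the body `A` of an abstraction with its bound variable replaced by `B`. -/
def Term.inst {Γ : List (Ty n)} {α β : Ty n} (A : Term N K (β :: Γ) α) (B : Term N K Γ β) :
    Term N K Γ α :=
  A.subst (Sub.single B)

/-! ### Defined logical symbols (as in the equality-based systems of Henkin, Andrews, Gallin) -/

section Logic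

variable {Γ : List (Ty n)}

/-- The three innermost bound variables. -/
abbrev Term.v0 {α : Ty n} : Term N K (α :: Γ) α := .bvar Var.zero
/-- See `Term.v0`. -/
abbrev Term.v1 {α β : Ty n} : Term N K (β :: α :: Γ) α := .bvar (Var.succ Var.zero)
/-- See `Term.v0`. -/
abbrev Term.v2 {α β γ : Ty n} : Term N K (γ :: β :: α :: Γ) α :=
  .bvar (Var.succ (Var.succ Var.zero))

/-- The true value: `λx_t x_t = λx_t x_t`. -/
def Term.tru : Term N K Γ Ty.t :=
  .eq (.lam (.v0 : Term N K (Ty.t :: Γ) Ty.t)) (.lam .v0)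

/-- `∀x_α A`, i.e. `λx_α T = λx_α A`. -/
def Term.all {α : Ty n} (A : Term N K (α :: Γ) Ty.t) : Term N K Γ Ty.t :=
  .eq (.lam .tru) (.lam A)

/-- The false value: `∀x_t x_t`. -/
def Term.fls : Term N K Γ Ty.t :=
  .all (.v0 : Term N K (Ty.t :: Γ) Ty.t)

/-- `¬A`, i.e. `F = A`. -/
def Term.not (A : Term N K Γ Ty.t) : Term N K Γ Ty.t := .eq .fls A

/-- `A ∧ B`, i.e. `λg_{ttt} (g T T) = λg_{ttt} (g A B)`. -/
def Term.and (A B : Term N K Γ Ty.t) : Term N K Γ Ty.t :=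
  .eq
    (.lam (α := Ty.t ⇒ Ty.t ⇒ Ty.t) (.app (.app .v0 .tru) .tru))
    (.lam (α := Ty.t ⇒ Ty.t ⇒ Ty.t) (.app (.app .v0 (A.shift _)) (B.shift _)))

/-- `A → B`, i.e. `A = (A ∧ B)`. -/
def Term.imp (A B : Term N K Γ Ty.t) : Term N K Γ Ty.t := .eq A (.and A B)

/-- `A ∨ B`, i.e. `¬(¬A ∧ ¬B)`. -/
def Term.or (A B : Term N K Γ Ty.t) : Term N K Γ Ty.t := .not (.and (.not A) (.not B))

/-- `∃x_α A`, i.e. `¬∀x_α ¬A`. -/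
def Term.ex {α : Ty n} (A : Term N K (α :: Γ) Ty.t) : Term N K Γ Ty.t := .not (.all (.not A))

/-! ### The non-logical axioms of `Ty_n^𝒜` -/

/-- The empty symbol `C^0_s`. -/
abbrev Term.eps : Term N K Γ Ty.sym := .const .eps

/-- The letter `C^i_s`. -/
abbrev Term.letter (i : Fin N) : Term N K Γ Ty.sym := .const (.letter i)

/-- Concatenation `A + B` of terms of type `s`. -/
def Term.cat (A B : Term N K Γ Ty.sym) : Term N K Γ Ty.sym := .app (.app (.const .concat) A) B

/-- `∀x ((x + C^0 = x) ∧ (C^0 + x = x))`. -/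
def Term.axUnit : Term N K Γ Ty.t :=
  .all (α := Ty.sym) (.and (.eq (.cat .v0 .eps) .v0) (.eq (.cat .eps .v0) .v0))

/-- `∀x ∀y ∀z ((x + y) + z = x + (y + z))`. -/
def Term.axAssoc : Term N K Γ Ty.t :=
  .all (α := Ty.sym) (.all (α := Ty.sym) (.all (α := Ty.sym)
    (.eq (.cat (.cat .v2 .v1) .v0) (.cat .v2 (.cat .v1 .v0)))))

/-- `∀x ∀y ∀z (x + C^i + y ≠ x + C^j + z)`. -/
def Term.axLetter (i j : Fin N) : Term N K Γ Ty.t :=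
  .all (α := Ty.sym) (.all (α := Ty.sym) (.all (α := Ty.sym)
    (.not (.eq (.cat .v2 (.cat (.letter i) .v1)) (.cat .v2 (.cat (.letter j) .v0))))))

end Logic

/-! ### Provability -/

/-- `Prov H A` is `H ⊢ A` in `Ty_n^𝒜` with further constants `K`: the system `Q_0` of Andrews,
generalized to the individual types `e_1, …, e_n` and to product types, with the description
operator at every type, plus the axioms of the symbolic type.  `H` is a set of hypotheses, whose
free variables are kept fixed. Andrews' rule of replacement of a subterm by an equal one is given by
`mpEq` and the congruence rules; in `congLam` the newly bound variable is fresh for `H`. -/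
inductive Prov : {Γ : List (Ty n)} → Set (Term N K Γ Ty.t) → Term N K Γ Ty.t → Prop
  /- Hypotheses. -/
  | hyp {Γ : List (Ty n)} {H : Set (Term N K Γ Ty.t)} {A : Term N K Γ Ty.t} (h : A ∈ H) : Prov H A
  /- Rule of replacement. -/
  | mpEq {Γ : List (Ty n)} {H : Set (Term N K Γ Ty.t)} {A B : Term N K Γ Ty.t}
      (h : Prov H (.eq A B)) (hA : Prov H A) : Prov H B
  | refl {Γ : List (Ty n)} {H : Set (Term N K Γ Ty.t)} {α : Ty n} (A : Term N K Γ α) :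
      Prov H (.eq A A)
  | congApp {Γ : List (Ty n)} {H : Set (Term N K Γ Ty.t)} {α β : Ty n}
      {A A' : Term N K Γ (α ⇒ β)} {B B' : Term N K Γ α}
      (hA : Prov H (.eq A A')) (hB : Prov H (.eq B B')) : Prov H (.eq (.app A B) (.app A' B'))
  | congLam {Γ : List (Ty n)} {H : Set (Term N K Γ Ty.t)} {α β : Ty n}
      {A A' : Term N K (α :: Γ) β} (h : Prov (Term.shift α '' H) (.eq A A')) :
      Prov H (.eq (.lam A) (.lam A'))
  | congEq {Γ : List (Ty n)} {H : Set (Term N K Γ Ty.t)} {α : Ty n} {A A' B B' : Term N K Γ α}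
      (hA : Prov H (.eq A A')) (hB : Prov H (.eq B B')) : Prov H (.eq (.eq A B) (.eq A' B'))
  | congPair {Γ : List (Ty n)} {H : Set (Term N K Γ Ty.t)} {α β : Ty n}
      {A A' : Term N K Γ α} {B B' : Term N K Γ β}
      (hA : Prov H (.eq A A')) (hB : Prov H (.eq B B')) : Prov H (.eq (.pair A B) (.pair A' B'))
  | congFst {Γ : List (Ty n)} {H : Set (Term N K Γ Ty.t)} {α β : Ty n}
      {A A' : Term N K Γ (Ty.prod α β)} (h : Prov H (.eq A A')) : Prov H (.eq (.fst A) (.fst A'))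
  | congSnd {Γ : List (Ty n)} {H : Set (Term N K Γ Ty.t)} {α β : Ty n}
      {A A' : Term N K Γ (Ty.prod α β)} (h : Prov H (.eq A A')) : Prov H (.eq (.snd A) (.snd A'))
  /- Two truth values: `(g T ∧ g F) = ∀x_t (g x)`. -/
  | bool {Γ : List (Ty n)} {H : Set (Term N K Γ Ty.t)} (G : Term N K Γ (Ty.t ⇒ Ty.t)) :
      Prov H (.eq (.and (.app G .tru) (.app G .fls)) (.all (.app (G.shift Ty.t) .v0)))
  /- Equals have the same properties: `A = B → (P A = P B)`. -/
  | leibniz {Γ : List (Ty n)} {H : Set (Term N K Γ Ty.t)} {α : Ty n} (A B : Term N K Γ α)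
      (P : Term N K Γ (α ⇒ Ty.t)) :
      Prov H (.imp (.eq A B) (.eq (.app P A) (.app P B)))
  /- Extensionality: `(F = G) = ∀x (F x = G x)`. -/
  | ext {Γ : List (Ty n)} {H : Set (Term N K Γ Ty.t)} {α β : Ty n} (F G : Term N K Γ (α ⇒ β)) :
      Prov H (.eq (.eq F G) (.all (.eq (.app (F.shift α) .v0) (.app (G.shift α) .v0))))
  /- Conversion: `(λx A) B = A(B)`. -/
  | beta {Γ : List (Ty n)} {H : Set (Term N K Γ Ty.t)} {α β : Ty n} (A : Term N K (α :: Γ) β)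
      (B : Term N K Γ α) : Prov H (.eq (.app (.lam A) B) (A.inst B))
  /- Description: `ι λx (A = x) = A`. -/
  | descr {Γ : List (Ty n)} {H : Set (Term N K Γ Ty.t)} {α : Ty n} (A : Term N K Γ α) :
      Prov H (.eq (.app (.iota α) (.lam (.eq (A.shift α) .v0))) A)
  /- Pairs. -/
  | fstPair {Γ : List (Ty n)} {H : Set (Term N K Γ Ty.t)} {α β : Ty n} (A : Term N K Γ α)
      (B : Term N K Γ β) : Prov H (.eq (.fst (.pair A B)) A)
  | sndPair {Γ : List (Ty n)} {H : Set (Term N K Γ Ty.t)} {α β : Ty n} (A : Term N K Γ α)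
      (B : Term N K Γ β) : Prov H (.eq (.snd (.pair A B)) B)
  | pairEta {Γ : List (Ty n)} {H : Set (Term N K Γ Ty.t)} {α β : Ty n}
      (A : Term N K Γ (Ty.prod α β)) : Prov H (.eq (.pair (.fst A) (.snd A)) A)
  /- The symbolic type. -/
  | unit {Γ : List (Ty n)} {H : Set (Term N K Γ Ty.t)} : Prov H .axUnit
  | assoc {Γ : List (Ty n)} {H : Set (Term N K Γ Ty.t)} : Prov H .axAssoc
  | letter {Γ : List (Ty n)} {H : Set (Term N K Γ Ty.t)} (i j : Fin N) (hij : i < j) :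
      Prov H (.axLetter i j)

/-- A set of formulas is consistent if it does not prove the false value. -/
def Consistent (H : Set (Term N K [] Ty.t)) : Prop := ¬ Prov H .fls

/-! ### Predicates, words, translation -/

section Operators

variable {Γ : List (Ty n)}

/-- The predicate `(= A)`, i.e. `λx_α (x_α = A)`. -/
def Term.eqTo {α : Ty n} (A : Term N K Γ α) : Term N K Γ (α ⇒ Ty.t) :=
  .lam (.eq .v0 (A.shift α))

/-- Disjunction of predicates, `λx_α (P x_α ∨ Q x_α)`. -/
def Term.orPred {α : Ty n} (P Q : Term N K Γ (α ⇒ Ty.t)) : Term N K Γ (α ⇒ Ty.t) :=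
  .lam (.or (.app (P.shift α) .v0) (.app (Q.shift α) .v0))

/-- Disjunction of binary predicates, `λx_β (P x_β ∨ Q x_β)`. -/
def Term.orRel {α β : Ty n} (P Q : Term N K Γ (β ⇒ α ⇒ Ty.t)) : Term N K Γ (β ⇒ α ⇒ Ty.t) :=
  .lam (.orPred (.app (P.shift β) .v0) (.app (Q.shift β) .v0))

/-- Disjunction of a finite list of predicates; the empty one is `λx_α F`. -/
def Term.bigOr {α : Ty n} : List (Term N K Γ (α ⇒ Ty.t)) → Term N K Γ (α ⇒ Ty.t)
  | [] => .lam .fls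
  | [P] => P
  | P :: Q :: l => .orPred P (Term.bigOr (Q :: l))

/-- The term `T_A(w)`, also written `/w/`, that denotes the word `w`. -/
def Term.word : List (Fin N) → Term N K Γ Ty.sym
  | [] => .eps
  | [a] => .letter a
  | a :: b :: l => .cat (.letter a) (Term.word (b :: l))

/-- The description operator of type `(αt)α`.  At a product type `β × γ` it is
`λz (ι λx_β ∃x_γ z (x_β, x_γ), ι λx_γ ∃x_β z (x_β, x_γ))`, recursively; at other types it is
the primitive one. -/
def Term.desc {Γ : List (Ty n)} : (α : Ty n) → Term N K Γ ((α ⇒ Ty.t) ⇒ α)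
  | .prod β γ =>
      .lam (.pair
        (.app (Term.desc β) (.lam (.ex (α := γ) (.app .v2 (.pair .v1 .v0)))))
        (.app (Term.desc γ) (.lam (.ex (α := β) (.app .v2 (.pair .v0 .v1))))))
  | .t => .iota _
  | .ind _ => .iota _
  | .fn _ _ => .iota _

/-- The translation operator `τ`, i.e. `λx_{sαt} λx_s (ι (x_{sαt} x_s))`. -/
def Term.trans (α : Ty n) : Term N K Γ ((Ty.sym ⇒ α ⇒ Ty.t) ⇒ Ty.sym ⇒ α) :=
  .lam (.lam (.app (Term.desc α) (.app .v1 .v0)))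

/-- The self-extension `L⁺`, i.e. `L ∨ λx_s (= τ L x_s)`. -/
def Term.selfExt {α : Ty n} (L : Term N K Γ (Ty.sym ⇒ α ⇒ Ty.t)) :
    Term N K Γ (Ty.sym ⇒ α ⇒ Ty.t) :=
  .orRel L (.lam (.eqTo (.app (.app (Term.trans α) (L.shift Ty.sym)) .v0)))

end Operators

/-! ### Languages and their representations

`K` are the constants of `Ty_n^𝒜` (besides the symbolic ones) and `K'` those added in `Ty_n^{𝒜+}`.
As the added constants have no axioms, provability of a `Ty_n^𝒜` formula may be, and is, taken in
`Ty_n^{𝒜+}`. -/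

/-- The constants of the extension `Ty_n^{𝒜+}`. -/
abbrev Plus (K : Ty n → Type u) (K' : Ty n → Type v) : Ty n → Type (max u v) :=
  fun α => K α ⊕ K' α

/-- A `Ty_n^𝒜` constant as a `Ty_n^{𝒜+}` constant. -/
def Const.incl (K' : Ty n → Type v) {α : Ty n} : Const N K α → Const N (Plus K K') α
  | .eps => .eps
  | .letter i => .letter i
  | .concat => .concat
  | .other c => .other (Sum.inl c)

/-- A `Ty_n^𝒜` term as a `Ty_n^{𝒜+}` term. -/
def Term.incl (K' : Ty n → Type v) {Γ : List (Ty n)} {α : Ty n} :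
    Term N K Γ α → Term N (Plus K K') Γ α
  | .fvar α i => .fvar α i
  | .bvar x => .bvar x
  | .const c => .const (c.incl K')
  | .iota α => .iota α
  | .app A B => .app (A.incl K') (B.incl K')
  | .lam A => .lam (A.incl K')
  | .eq A B => .eq (A.incl K') (B.incl K')
  | .pair A B => .pair (A.incl K') (B.incl K')
  | .fst A => .fst (A.incl K')
  | .snd A => .snd (A.incl K')

/-- An `α`-language: a relation between words over the alphabet and `α`-terms. -/
abbrev Lang (N : ℕ) (K : Ty n → Type u) (α : Ty n) : Type u :=
  Set (List (Fin N) × Term N K [] α)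

/-- `w` is a valid expression of the language: it has a meaning. -/
def Lang.Valid {α : Ty n} (𝓛 : Lang N K α) (w : List (Fin N)) : Prop :=
  ∃ A, (w, A) ∈ 𝓛

/-- `w` is ambiguous: it has two meanings that are not provably equal. -/
def Lang.Ambiguous (K' : Ty n → Type v) {α : Ty n} (𝓛 : Lang N K α)
    (w : List (Fin N)) : Prop :=
  ∃ B C, (w, B) ∈ 𝓛 ∧ (w, C) ∈ 𝓛 ∧
    ¬ Prov (∅ : Set (Term N (Plus K K') [] Ty.t)) (.eq (B.incl K') (C.incl K'))

/-- `(Δ, L)` represents the language `𝓛`. -/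
structure Represents {α : Ty n} (Δ : Set (Term N (Plus K K') [] Ty.t))
    (L : Term N (Plus K K') [] (Ty.sym ⇒ α ⇒ Ty.t)) (𝓛 : Lang N K α) : Prop where
  consistent : Consistent Δ
  mem_iff : ∀ (w : List (Fin N)) (A : Term N K [] α),
    (w, A) ∈ 𝓛 ↔ Prov Δ (.app (.app L (.word w)) (A.incl K'))

/-- `(Δ, L)` is a pseudo-canonic representation of the language `𝓛`. -/
structure PseudoCanonic {α : Ty n} (Δ : Set (Term N (Plus K K') [] Ty.t))
    (L : Term N (Plus K K') [] (Ty.sym ⇒ α ⇒ Ty.t)) (𝓛 : Lang N K α) : Prop where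
  represents : Represents Δ L 𝓛
  finite : ∀ w : List (Fin N), ∃ As : List (Term N K [] α),
    Prov Δ (.eq (.app L (.word w)) (.bigOr (As.map fun A => (A.incl K').eqTo)))
  conservative : ∀ φ : Term N K [] Ty.t,
    Prov (∅ : Set (Term N (Plus K K') [] Ty.t)) (φ.incl K') ↔ Prov Δ (φ.incl K')

end UHOG

open UHOG

/-! No deduction theorem is needed: propositional laws are checked on the two truth values, and
implications between equations come from Leibniz' law.

Write `P` for `L /w/`, so that `τ L /w/` is `ι P` and `L⁺ /w/` is `P ∨ (= ι P)`. By non-ambiguity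
the terms `A¹, …, Aˡ` with `P = (= A¹) ∨ … ∨ (= Aˡ)` are provably equal, so `P` is either empty or
of the form `(= A)`. If `P` is empty, then `P ∨ (= ι P)` is `(= ι P)`, which `ι` sends to `ι P`;
if `P` is `(= A)`, then `ι P = A` and `P ∨ (= ι P)` is `P` itself. -/

namespace UHOG

variable {n : ℕ}

/-! ### Substitution -/

section Substitution

variable {Γ Γ' Γ'' : List (Ty n)} {α β γ : Ty n}

theorem Ren.lift_comp (r : Ren Γ Γ') (s : Ren Γ' Γ'') (β : Ty n) :
    (fun α x => s.lift β α (r.lift β α x)) = Ren.lift (fun α x => s α (r α x)) β := by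
  funext α x
  cases x <;> rfl

variable [NeZero n] {N : ℕ} {K : Ty n → Type*}

theorem Term.rename_rename (A : Term N K Γ α) (r : Ren Γ Γ') (s : Ren Γ' Γ'') :
    (A.rename r).rename s = A.rename (fun α x => s α (r α x)) := by
  induction A generalizing Γ' Γ'' <;> simp_all [Term.rename, Ren.lift_comp]

theorem Term.shift_rename_lift (A : Term N K Γ α) (r : Ren Γ Γ') (β : Ty n) :
    (A.shift β).rename (r.lift β) = (A.rename r).shift β := by
  simp only [Term.shift, Term.rename_rename]
  rfl

theorem Sub.lift_comp_ren_lift (r : Ren Γ Γ') (σ : Sub N K Γ' Γ'') (β : Ty n) :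
    (fun α x => σ.lift β α (r.lift β α x)) = Sub.lift (fun α x => σ α (r α x)) β := by
  funext α x
  cases x <;> rfl

theorem Term.subst_rename (A : Term N K Γ α) (r : Ren Γ Γ') (σ : Sub N K Γ' Γ'') :
    (A.rename r).subst σ = A.subst (fun α x => σ α (r α x)) := by
  induction A generalizing Γ' Γ'' <;> simp_all [Term.rename, Term.subst, Sub.lift_comp_ren_lift]

theorem Sub.rename_lift (σ : Sub N K Γ Γ') (r : Ren Γ' Γ'') (β : Ty n) :
    (fun α x => (σ.lift β α x).rename (r.lift β)) =
      Sub.lift (fun α x => (σ α x).rename r) β := by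
  funext α x
  cases x with
  | zero => rfl
  | succ x => exact Term.shift_rename_lift _ _ _

theorem Term.rename_subst (A : Term N K Γ α) (σ : Sub N K Γ Γ') (r : Ren Γ' Γ'') :
    (A.subst σ).rename r = A.subst (fun α x => (σ α x).rename r) := by
  induction A generalizing Γ' Γ'' <;> simp_all [Term.rename, Term.subst, Sub.rename_lift]

theorem Sub.lift_bvar (β : Ty n) :
    Sub.lift (fun _ x => .bvar x : Sub N K Γ Γ) β = fun _ x => .bvar x := by
  funext α x
  cases x <;> rfl

theorem Term.subst_bvar (A : Term N K Γ α) : A.subst (fun _ x => .bvar x) = A := by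
  induction A <;> simp_all [Term.subst, Sub.lift_bvar]

@[simp]
theorem Term.shift_subst_lift (A : Term N K Γ α) (σ : Sub N K Γ Γ') (β : Ty n) :
    (A.shift β).subst (σ.lift β) = (A.subst σ).shift β := by
  simp only [Term.shift, Term.subst_rename, Term.rename_subst]
  rfl

@[simp]
theorem Term.shift_subst_single (A : Term N K Γ α) (B : Term N K Γ β) :
    (A.shift β).subst (Sub.single B) = A := by
  rw [Term.shift, Term.subst_rename]
  exact A.subst_bvar

@[simp]
theorem Term.rename_lift_subst_lift_single (A : Term N K (γ :: Γ) α) (B : Term N K Γ β) :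
    (A.rename (Ren.lift (fun _ x => Var.succ x) γ)).subst ((Sub.single B).lift γ) = A := by
  rw [Term.subst_rename, Sub.lift_comp_ren_lift]
  exact (congrArg A.subst (Sub.lift_bvar γ)).trans A.subst_bvar

@[simp]
theorem Term.rename_lift_subst_single (A : Term N K (β :: Γ) α) :
    (A.rename (Ren.lift (fun _ x => Var.succ x) β)).subst (Sub.single (.bvar Var.zero)) = A := by
  rw [Term.subst_rename]
  convert A.subst_bvar using 2
  funext γ x
  cases x <;> rfl

attribute [simp] Term.subst Term.inst

@[simp]
theorem Sub.lift_zero (σ : Sub N K Γ Γ') (β : Ty n) :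
    σ.lift β β Var.zero = .bvar Var.zero := rfl

@[simp]
theorem Sub.lift_succ (σ : Sub N K Γ Γ') (x : Var Γ α) (β : Ty n) :
    σ.lift β α (Var.succ x) = (σ α x).shift β := rfl

@[simp]
theorem Sub.single_zero (B : Term N K Γ β) : Sub.single B β Var.zero = B := rfl

@[simp]
theorem Term.shift_bvar (x : Var Γ α) (β : Ty n) :
    (.bvar x : Term N K Γ α).shift β = .bvar (Var.succ x) := rfl

@[simp]
theorem Term.shift_eq (A B : Term N K Γ α) (β : Ty n) :
    (Term.eq A B).shift β = .eq (A.shift β) (B.shift β) := rfl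

@[simp]
theorem Term.shift_fst (A : Term N K Γ (.prod α β)) (γ : Ty n) :
    (Term.fst A).shift γ = .fst (A.shift γ) := rfl

@[simp]
theorem Term.shift_snd (A : Term N K Γ (.prod α β)) (γ : Ty n) :
    (Term.snd A).shift γ = .snd (A.shift γ) := rfl

@[simp]
theorem Term.shift_tru (γ : Ty n) : (Term.tru : Term N K Γ Ty.t).shift γ = .tru := rfl

@[simp]
theorem Term.shift_fls (γ : Ty n) : (Term.fls : Term N K Γ Ty.t).shift γ = .fls := rfl

@[simp]
theorem Term.shift_eqTo (A : Term N K Γ α) (β : Ty n) :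
    A.eqTo.shift β = (A.shift β).eqTo :=
  congrArg (fun B => Term.lam (.eq .v0 B)) (A.shift_rename_lift _ α)

@[simp]
theorem Term.subst_tru (σ : Sub N K Γ Γ') : (Term.tru : Term N K Γ Ty.t).subst σ = .tru := rfl

@[simp]
theorem Term.subst_fls (σ : Sub N K Γ Γ') : (Term.fls : Term N K Γ Ty.t).subst σ = .fls := rfl

@[simp]
theorem Term.subst_not (A : Term N K Γ Ty.t) (σ : Sub N K Γ Γ') :
    A.not.subst σ = (A.subst σ).not := rfl

@[simp]
theorem Term.subst_ex (A : Term N K (β :: Γ) Ty.t) (σ : Sub N K Γ Γ') :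
    A.ex.subst σ = (A.subst (σ.lift β)).ex := rfl

@[simp]
theorem Term.subst_and (A B : Term N K Γ Ty.t) (σ : Sub N K Γ Γ') :
    (A.and B).subst σ = (A.subst σ).and (B.subst σ) := by
  simp [Term.and]

@[simp]
theorem Term.subst_or (A B : Term N K Γ Ty.t) (σ : Sub N K Γ Γ') :
    (A.or B).subst σ = (A.subst σ).or (B.subst σ) := by
  simp [Term.or]

@[simp]
theorem Term.subst_eqTo (A : Term N K Γ α) (σ : Sub N K Γ Γ') :
    A.eqTo.subst σ = (A.subst σ).eqTo := by
  simp [Term.eqTo]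

@[simp]
theorem Term.subst_orPred (P Q : Term N K Γ (α ⇒ Ty.t)) (σ : Sub N K Γ Γ') :
    (P.orPred Q).subst σ = (P.subst σ).orPred (Q.subst σ) := by
  simp [Term.orPred]

@[simp]
theorem Term.subst_desc (α : Ty n) (σ : Sub N K Γ Γ') : (Term.desc α).subst σ = .desc α := by
  induction α generalizing Γ Γ' <;> simp_all [Term.desc]

@[simp]
theorem Term.subst_trans (α : Ty n) (σ : Sub N K Γ Γ') : (Term.trans α).subst σ = .trans α := by
  simp [Term.trans]

end Substitution

variable [NeZero n] {N : ℕ} {K : Ty n → Type*} {K' : Ty n → Type*}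

namespace Prov

variable {Γ : List (Ty n)} {H : Set (Term N K Γ Ty.t)} {α β : Ty n}

/-! ### Equality -/

theorem symm {A B : Term N K Γ α} (h : Prov H (.eq A B)) : Prov H (.eq B A) :=
  mpEq (congEq h (refl A)) (refl A)

theorem trans {A B C : Term N K Γ α} (h : Prov H (.eq A B)) (h' : Prov H (.eq B C)) :
    Prov H (.eq A C) :=
  mpEq (congEq (refl A) h') h

theorem mpEq_symm {A B : Term N K Γ Ty.t} (h : Prov H (.eq A B)) (hB : Prov H B) : Prov H A :=
  mpEq h.symm hB

theorem beta_of_inst_eq {A : Term N K (α :: Γ) β} {B : Term N K Γ α} {C : Term N K Γ β}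
    (h : A.inst B = C) : Prov H (.eq (.app (.lam A) B) C) :=
  h ▸ beta A B

theorem congInst (C : Term N K (α :: Γ) β) {A B : Term N K Γ α} (h : Prov H (.eq A B)) :
    Prov H (.eq (C.inst A) (C.inst B)) :=
  (beta C A).symm.trans ((congApp (refl _) h).trans (beta C B))

theorem congAnd {A A' B B' : Term N K Γ Ty.t} (hA : Prov H (.eq A A'))
    (hB : Prov H (.eq B B')) : Prov H (.eq (A.and B) (A'.and B')) := by
  have hleft : Prov H (.eq (A.and B) (A'.and B)) := by
    simpa using congInst (.and .v0 (B.shift _)) hA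
  have hright : Prov H (.eq (A'.and B) (A'.and B')) := by
    simpa using congInst (.and (A'.shift _) .v0) hB
  exact hleft.trans hright

theorem congImp {A A' B B' : Term N K Γ Ty.t} (hA : Prov H (.eq A A'))
    (hB : Prov H (.eq B B')) : Prov H (.eq (A.imp B) (A'.imp B')) :=
  congEq hA (congAnd hA hB)

theorem congNot {A A' : Term N K Γ Ty.t} (hA : Prov H (.eq A A')) :
    Prov H (.eq A.not A'.not) :=
  congEq (refl _) hA

theorem congOr {A A' B B' : Term N K Γ Ty.t} (hA : Prov H (.eq A A'))
    (hB : Prov H (.eq B B')) : Prov H (.eq (A.or B) (A'.or B')) :=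
  congNot (congAnd (congNot hA) (congNot hB))

theorem congAll {A A' : Term N K (α :: Γ) Ty.t}
    (h : Prov (Term.shift α '' H) (.eq A A')) : Prov H (.eq A.all A'.all) :=
  congEq (refl _) (congLam h)

theorem congEx {A A' : Term N K (α :: Γ) Ty.t}
    (h : Prov (Term.shift α '' H) (.eq A A')) : Prov H (.eq A.ex A'.ex) :=
  congNot (congAll (congNot h))

theorem congOrPred {P P' Q Q' : Term N K Γ (α ⇒ Ty.t)} (hP : Prov H (.eq P P'))
    (hQ : Prov H (.eq Q Q')) : Prov H (.eq (P.orPred Q) (P'.orPred Q')) := by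
  have hleft : Prov H (.eq (P.orPred Q) (P'.orPred Q)) := by
    simpa using congInst (.orPred .v0 (Q.shift _)) hP
  have hright : Prov H (.eq (P'.orPred Q) (P'.orPred Q')) := by
    simpa using congInst (.orPred (P'.shift _) .v0) hQ
  exact hleft.trans hright

theorem congEqTo {A B : Term N K Γ α} (h : Prov H (.eq A B)) :
    Prov H (.eq A.eqTo B.eqTo) := by
  simpa using congInst (.eqTo .v0) h

/-! ### Propositional logic -/

theorem tru : Prov H .tru := refl _

theorem ext_lam (A B : Term N K (α :: Γ) β) :
    Prov H (.eq (.eq (.lam A) (.lam B)) (.all (.eq A B))) :=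
  (ext _ _).trans (congAll (congEq (beta_of_inst_eq (by simp)) (beta_of_inst_eq (by simp))))

theorem all_elim_eq {A : Term N K (α :: Γ) Ty.t} (h : Prov H A.all) (B : Term N K Γ α) :
    Prov H (.eq .tru (A.inst B)) :=
  (beta .tru B).symm.trans ((congApp h (refl B)).trans (beta A B))

theorem all_elim {A : Term N K (α :: Γ) Ty.t} (h : Prov H A.all) (B : Term N K Γ α) :
    Prov H (A.inst B) :=
  mpEq (all_elim_eq h B) tru

theorem eq_self (A : Term N K Γ α) : Prov H (.eq (.eq A A) .tru) := by
  have h : Prov H (.all (.eq .v0 .v0 : Term N K (α :: Γ) Ty.t)) :=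
    mpEq (ext_lam .v0 .v0) (refl _)
  simpa using (all_elim_eq h A).symm

theorem eq_eq_tru {A B : Term N K Γ α} (h : Prov H (.eq A B)) :
    Prov H (.eq (.eq A B) .tru) :=
  (congEq h (refl B)).trans (eq_self B)

-- By definition, `T ∧ T` is an equation with identical sides.
theorem tru_and_tru : Prov H (.eq (.and .tru .tru) .tru) := eq_self _

theorem bool_lam (C : Term N K (Ty.t :: Γ) Ty.t) :
    Prov H (.eq (.and (C.inst .tru) (C.inst .fls)) C.all) :=
  (congAnd (beta _ _).symm (beta _ _).symm).trans
    ((bool (.lam C)).trans (congAll (beta_of_inst_eq (by simp))))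

theorem eq_of_truth_values (A B : Term N K (Ty.t :: Γ) α)
    (htru : Prov H (.eq (A.inst .tru) (B.inst .tru)))
    (hfls : Prov H (.eq (A.inst .fls) (B.inst .fls))) (φ : Term N K Γ Ty.t) :
    Prov H (.eq (A.inst φ) (B.inst φ)) := by
  have hand : Prov H (.eq (.and ((Term.eq A B).inst .tru) ((Term.eq A B).inst .fls)) .tru) :=
    (congAnd (eq_eq_tru htru) (eq_eq_tru hfls)).trans tru_and_tru
  exact all_elim (mpEq (bool_lam (.eq A B)) (mpEq_symm hand tru)) φ

theorem tru_and_fls : Prov H (.eq (.and .tru .fls) .fls) :=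
  bool_lam .v0

theorem tru_and (A : Term N K Γ Ty.t) : Prov H (.eq (.and .tru A) A) := by
  simpa using eq_of_truth_values (.and .tru .v0) .v0
    (by simpa using tru_and_tru) (by simpa using tru_and_fls) A

-- The axiom for the two truth values at `λx (T = x)` reads `((T = T) ∧ (T = F)) = ∀x (T = x)`,
-- and by extensionality its right-hand side is `F`, i.e. `λx T = λx x`.
theorem tru_eq_fls : Prov H (.eq (.eq .tru .fls) .fls) := by
  have h : Prov H (.eq (.and (.eq .tru .tru) (.eq .tru .fls)) (.all (.eq .tru .v0))) := by
    simpa using bool_lam (H := H) (.eq .tru .v0)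
  exact (tru_and _).symm.trans ((congAnd (eq_self _).symm (refl _)).trans
    (h.trans (ext_lam _ _).symm))

theorem tru_eq (A : Term N K Γ Ty.t) : Prov H (.eq (.eq .tru A) A) := by
  simpa using eq_of_truth_values (.eq .tru .v0) .v0
    (by simpa using eq_self _) (by simpa using tru_eq_fls) A

theorem eq_tru {A : Term N K Γ Ty.t} (h : Prov H A) : Prov H (.eq A .tru) :=
  (mpEq_symm (tru_eq A) h).symm

theorem of_eq_tru {A : Term N K Γ Ty.t} (h : Prov H (.eq A .tru)) : Prov H A :=
  mpEq_symm h tru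

theorem all_intro {A : Term N K (α :: Γ) Ty.t} (h : Prov (Term.shift α '' H) A) :
    Prov H A.all :=
  congLam (eq_tru h).symm

theorem eq_imp_inst (C : Term N K (α :: Γ) Ty.t) {A : Term N K Γ α} (hA : Prov H (C.inst A))
    (B : Term N K Γ α) : Prov H (.imp (.eq A B) (C.inst B)) := by
  have hC : Prov H (.eq (.eq (.app (.lam C) A) (.app (.lam C) B)) (C.inst B)) :=
    (congEq ((beta C A).trans (eq_tru hA)) (beta C B)).trans (tru_eq _)
  exact mpEq (congImp (refl _) hC) (leibniz A B (.lam C))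

theorem all_imp_inst (A : Term N K (α :: Γ) Ty.t) (B : Term N K Γ α) :
    Prov H (.imp A.all (A.inst B)) := by
  have htru : Prov H (.app (.lam .tru) B) := mpEq_symm (beta .tru B) tru
  have h : Prov H (.imp (.eq (.lam .tru) (.lam A)) (.app (.lam A) B)) := by
    simpa using eq_imp_inst (.app .v0 (B.shift _)) (by simpa using htru) (.lam A)
  exact mpEq (congImp (refl _) (beta A B)) h

theorem fls_and (A : Term N K Γ Ty.t) : Prov H (.eq (.and .fls A) .fls) :=
  (all_imp_inst .v0 A).symm

theorem and_tru (A : Term N K Γ Ty.t) : Prov H (.eq (.and A .tru) A) := by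
  simpa using eq_of_truth_values (.and .v0 .tru) .v0
    (by simpa using tru_and _) (by simpa using fls_and _) A

theorem and_fls (A : Term N K Γ Ty.t) : Prov H (.eq (.and A .fls) .fls) := by
  simpa using eq_of_truth_values (.and .v0 .fls) .fls
    (by simpa using tru_and _) (by simpa using fls_and _) A

theorem and_self (A : Term N K Γ Ty.t) : Prov H (.eq (.and A A) A) := by
  simpa using eq_of_truth_values (.and .v0 .v0) .v0
    (by simpa using tru_and _) (by simpa using fls_and _) A

theorem and_comm (A B : Term N K Γ Ty.t) : Prov H (.eq (.and A B) (.and B A)) := by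
  simpa using eq_of_truth_values (.and .v0 (B.shift _)) (.and (B.shift _) .v0)
    (by simpa using (tru_and B).trans (and_tru B).symm)
    (by simpa using (fls_and B).trans (and_fls B).symm) A

theorem imp_antisymm {A B : Term N K Γ Ty.t} (h : Prov H (.imp A B)) (h' : Prov H (.imp B A)) :
    Prov H (.eq A B) :=
  h.trans ((and_comm A B).trans h'.symm)

theorem eq_fls_of_imp_fls {A : Term N K Γ Ty.t} (h : Prov H (.imp A .fls)) :
    Prov H (.eq A .fls) :=
  h.trans (and_fls A)

theorem eq_imp_symm (A B : Term N K Γ α) : Prov H (.imp (.eq A B) (.eq B A)) := by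
  simpa using eq_imp_inst (.eq .v0 (A.shift _)) (by simpa using refl A) B

theorem eq_comm (A B : Term N K Γ α) : Prov H (.eq (.eq A B) (.eq B A)) :=
  imp_antisymm (eq_imp_symm A B) (eq_imp_symm B A)

theorem not_tru : Prov H (.eq (.not .tru) .fls) :=
  (eq_comm _ _).trans tru_eq_fls

theorem not_fls : Prov H (.eq (.not .fls) .tru) := eq_self _

theorem not_not (A : Term N K Γ Ty.t) : Prov H (.eq A.not.not A) := by
  simpa using eq_of_truth_values (.not (.not .v0)) .v0
    (by simpa using (congNot not_tru).trans not_fls)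
    (by simpa using (congNot not_fls).trans not_tru) A

theorem or_self (A : Term N K Γ Ty.t) : Prov H (.eq (.or A A) A) :=
  (congNot (and_self _)).trans (not_not A)

theorem fls_or (A : Term N K Γ Ty.t) : Prov H (.eq (.or .fls A) A) :=
  (congNot ((congAnd not_fls (refl _)).trans (tru_and _))).trans (not_not A)

theorem tru_or (A : Term N K Γ Ty.t) : Prov H (.eq (.or .tru A) .tru) :=
  (congNot ((congAnd not_tru (refl _)).trans (fls_and _))).trans not_fls

theorem or_tru (A : Term N K Γ Ty.t) : Prov H (.eq (.or A .tru) .tru) :=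
  (congNot ((congAnd (refl _) not_tru).trans (and_fls _))).trans not_fls

theorem or_of_left {A : Term N K Γ Ty.t} (h : Prov H A) (B : Term N K Γ Ty.t) :
    Prov H (.or A B) :=
  of_eq_tru ((congOr (eq_tru h) (refl B)).trans (tru_or B))

theorem or_of_right (A : Term N K Γ Ty.t) {B : Term N K Γ Ty.t} (h : Prov H B) :
    Prov H (.or A B) :=
  of_eq_tru ((congOr (refl A) (eq_tru h)).trans (or_tru A))

/-! ### Existential quantification and descriptions -/

theorem ex_intro {A : Term N K (α :: Γ) Ty.t} (B : Term N K Γ α) (h : Prov H (A.inst B)) :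
    Prov H A.ex := by
  have hnot : Prov H (.eq (A.not.inst B) .fls) := (congNot (eq_tru h)).trans not_tru
  have hall : Prov H (.imp A.not.all .fls) :=
    mpEq (congImp (refl _) hnot) (all_imp_inst A.not B)
  exact (eq_fls_of_imp_fls hall).symm

theorem ex_fls : Prov H (.eq (.ex (.fls : Term N K (α :: Γ) Ty.t)) .fls) :=
  (congNot ((congAll not_fls).trans (eq_self _))).trans not_tru

theorem ex_and (A : Term N K (α :: Γ) Ty.t) (B : Term N K Γ Ty.t) :
    Prov H (.eq (.ex (.and A (B.shift α))) (.and A.ex B)) := by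
  simpa using eq_of_truth_values
    (.ex (.and (A.rename (Ren.lift (fun _ x => Var.succ x) α)) .v1))
    (.and (.ex (A.rename (Ren.lift (fun _ x => Var.succ x) α))) .v0)
    (by simpa using (congEx (and_tru A)).trans (and_tru _).symm)
    (by simpa using (congEx (and_fls A)).trans (ex_fls.trans (and_fls _).symm)) B

theorem ex_imp {A : Term N K (α :: Γ) Ty.t} {B : Term N K Γ Ty.t}
    (h : Prov (Term.shift α '' H) (.imp A (B.shift α))) : Prov H (.imp A.ex B) :=
  (congEx h).trans (ex_and A B)

theorem ex_pair_eq_right (A : Term N K Γ α) (C : Term N K Γ (.prod α β)) :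
    Prov H (.eq (.ex (.eq (.pair (A.shift β) .v0) (C.shift β))) (.eq A (.fst C))) := by
  refine imp_antisymm (ex_imp ?_) (mpEq (congImp (eq_comm _ _) (refl _)) ?_)
  · simpa using eq_imp_inst (.eq ((A.shift β).shift _) (.fst .v0))
      (by simpa using (fstPair (A.shift β) .v0).symm) (C.shift β)
  · have h : Prov H (.ex (.eq (.pair ((Term.fst C).shift β) .v0) (C.shift β))) :=
      ex_intro (.snd C) (by simpa using pairEta C)
    simpa using eq_imp_inst (.ex (.eq (.pair .v1 .v0) ((C.shift _).shift _)))
      (by simpa using h) A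

theorem ex_pair_eq_left (B : Term N K Γ β) (C : Term N K Γ (.prod α β)) :
    Prov H (.eq (.ex (.eq (.pair .v0 (B.shift α)) (C.shift α))) (.eq B (.snd C))) := by
  refine imp_antisymm (ex_imp ?_) (mpEq (congImp (eq_comm _ _) (refl _)) ?_)
  · simpa using eq_imp_inst (.eq ((B.shift α).shift _) (.snd .v0))
      (by simpa using (sndPair .v0 (B.shift α)).symm) (C.shift α)
  · have h : Prov H (.ex (.eq (.pair .v0 ((Term.snd C).shift α)) (C.shift α))) :=
      ex_intro (.fst C) (by simpa using pairEta C)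
    simpa using eq_imp_inst (.ex (.eq (.pair .v0 .v1) ((C.shift _).shift _)))
      (by simpa using h) B

theorem eqTo_app (A B : Term N K Γ α) : Prov H (.eq (.app A.eqTo B) (.eq B A)) :=
  beta_of_inst_eq (by simp)

theorem iota_eqTo (A : Term N K Γ α) : Prov H (.eq (.app (.iota α) A.eqTo) A) :=
  (congApp (refl _) (congLam (eq_comm _ _))).trans (descr A)

theorem lam_ex_eqTo_pair_right (A : Term N K Γ (.prod α β)) :
    Prov H (.eq (.lam (.ex (.app (((A.shift α).shift β).eqTo) (.pair .v1 .v0))))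
      (Term.fst A).eqTo) :=
  congLam ((congEx (eqTo_app _ _)).trans (ex_pair_eq_right .v0 (A.shift α)))

theorem lam_ex_eqTo_pair_left (A : Term N K Γ (.prod α β)) :
    Prov H (.eq (.lam (.ex (.app (((A.shift β).shift α).eqTo) (.pair .v0 .v1))))
      (Term.snd A).eqTo) :=
  congLam ((congEx (eqTo_app _ _)).trans (ex_pair_eq_left .v0 (A.shift β)))

theorem desc_eqTo (A : Term N K Γ α) : Prov H (.eq (.app (.desc α) A.eqTo) A) := by
  induction α generalizing Γ with
  | t => exact iota_eqTo A
  | ind i => exact iota_eqTo A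
  | fn α β => exact iota_eqTo A
  | prod α β ihα ihβ =>
    have hfst := (congApp (refl _) (lam_ex_eqTo_pair_right A)).trans (ihα (H := H) (.fst A))
    have hsnd := (congApp (refl _) (lam_ex_eqTo_pair_left A)).trans (ihβ (H := H) (.snd A))
    exact (beta_of_inst_eq (by simp)).trans ((congPair hfst hsnd).trans (pairEta A))

/-! ### Disjunctions of predicates and self-extension -/

theorem orPred_app (P Q : Term N K Γ (α ⇒ Ty.t)) (A : Term N K Γ α) :
    Prov H (.eq (.app (P.orPred Q) A) (.or (.app P A) (.app Q A))) :=
  beta_of_inst_eq (by simp)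

theorem eta (P : Term N K Γ (α ⇒ β)) : Prov H (.eq (.lam (.app (P.shift α) .v0)) P) :=
  mpEq_symm (ext _ P) (all_intro (beta_of_inst_eq (by simp)))

theorem orPred_self (P : Term N K Γ (α ⇒ Ty.t)) : Prov H (.eq (P.orPred P) P) :=
  (congLam (or_self _)).trans (eta P)

theorem fls_orPred (P : Term N K Γ (α ⇒ Ty.t)) :
    Prov H (.eq ((Term.lam .fls).orPred P) P) :=
  (congLam ((congOr (beta .fls _) (refl _)).trans (fls_or _))).trans (eta P)

theorem bigOr_app_of_mem {l : List (Term N K Γ (α ⇒ Ty.t))} {P : Term N K Γ (α ⇒ Ty.t)}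
    (hP : P ∈ l) {A : Term N K Γ α} (h : Prov H (.app P A)) :
    Prov H (.app (.bigOr l) A) := by
  induction l using Term.bigOr.induct with
  | case1 => simp at hP
  | case2 Q =>
    obtain rfl := List.mem_singleton.1 hP
    exact h
  | case3 Q R l ih =>
    rcases List.mem_cons.1 hP with rfl | hP
    · exact mpEq_symm (orPred_app _ _ _) (or_of_left h _)
    · exact mpEq_symm (orPred_app _ _ _) (or_of_right _ (ih hP))

theorem bigOr_eq {l : List (Term N K Γ (α ⇒ Ty.t))} (hl : l ≠ []) {P : Term N K Γ (α ⇒ Ty.t)}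
    (h : ∀ Q ∈ l, Prov H (.eq Q P)) : Prov H (.eq (.bigOr l) P) := by
  induction l using Term.bigOr.induct with
  | case1 => exact absurd rfl hl
  | case2 Q => exact h Q List.mem_cons_self
  | case3 Q R l ih =>
    have hQ : Prov H (.eq Q P) := h Q List.mem_cons_self
    have hl : Prov H (.eq (.bigOr (R :: l)) P) :=
      ih (List.cons_ne_nil R l) fun S hS => h S (List.mem_cons_of_mem Q hS)
    exact (congOrPred hQ hl).trans (orPred_self P)

theorem desc_orPred_of_eq_empty {P : Term N K Γ (α ⇒ Ty.t)} (hP : Prov H (.eq P (.lam .fls)))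
    (A : Term N K Γ α) : Prov H (.eq (.app (.desc α) (P.orPred A.eqTo)) A) :=
  (congApp (refl _) ((congOrPred hP (refl _)).trans (fls_orPred _))).trans (desc_eqTo A)

theorem orPred_desc_of_eq_eqTo {P : Term N K Γ (α ⇒ Ty.t)} {A : Term N K Γ α}
    (hP : Prov H (.eq P A.eqTo)) :
    Prov H (.eq (P.orPred (Term.app (.desc α) P).eqTo) P) := by
  have hdesc : Prov H (.eq (.app (.desc α) P) A) :=
    (congApp (refl _) hP).trans (desc_eqTo A)
  exact (congOrPred (refl P) ((congEqTo hdesc).trans hP.symm)).trans (orPred_self P)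

theorem trans_app (L : Term N K Γ (Ty.sym ⇒ α ⇒ Ty.t)) (W : Term N K Γ Ty.sym) :
    Prov H (.eq (.app (.app (.trans α) L) W) (.app (.desc α) (.app L W))) :=
  (congApp (beta _ _) (refl _)).trans (beta_of_inst_eq (by simp))

theorem selfExt_app (L : Term N K Γ (Ty.sym ⇒ α ⇒ Ty.t)) (W : Term N K Γ Ty.sym) :
    Prov H (.eq (.app L.selfExt W)
      ((Term.app L W).orPred (Term.app (.desc α) (.app L W)).eqTo)) := by
  have hrel : Prov H (.eq (.app (.lam (.eqTo (.app (.app (.trans α) (L.shift _)) .v0))) W)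
      (Term.app (.desc α) (.app L W)).eqTo) :=
    (beta_of_inst_eq (by simp)).trans (congEqTo (trans_app L W))
  exact (beta_of_inst_eq (by simp)).trans (congOrPred (refl (.app L W)) hrel)

end Prov

/-! ### Languages and their representations -/

section Languages

variable {α : Ty n} {Δ : Set (Term N (Plus K K') [] Ty.t)}
  {L : Term N (Plus K K') [] (Ty.sym ⇒ α ⇒ Ty.t)} {𝓛 : Lang N K α} {w : List (Fin N)}

theorem Lang.Ambiguous.valid (h : 𝓛.Ambiguous K' w) : 𝓛.Valid w :=
  let ⟨B, _, hB, _⟩ := h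
  ⟨B, hB⟩

theorem Represents.mem_of_eq_bigOr (hL : Represents Δ L 𝓛) {As : List (Term N K [] α)}
    (hAs : Prov Δ (.eq (.app L (.word w)) (.bigOr (As.map fun A => (A.incl K').eqTo))))
    {A : Term N K [] α} (hA : A ∈ As) : (w, A) ∈ 𝓛 := by
  have heqTo : Prov Δ (.app (A.incl K').eqTo (A.incl K')) :=
    .mpEq_symm (.eqTo_app _ _) (.refl _)
  exact (hL.mem_iff w A).2 (.mpEq_symm (.congApp hAs (.refl _))
    (.bigOr_app_of_mem (List.mem_map_of_mem hA) heqTo))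

theorem PseudoCanonic.exists_eq_bigOr_of_not_ambiguous (hL : PseudoCanonic Δ L 𝓛)
    (hw : ¬ 𝓛.Ambiguous K' w) :
    ∃ As : List (Term N (Plus K K') [] α),
      Prov Δ (.eq (.app L (.word w)) (.bigOr (As.map Term.eqTo))) ∧
        ∀ A ∈ As, ∀ B ∈ As, Prov Δ (.eq A B) := by
  obtain ⟨As, hAs⟩ := hL.finite w
  refine ⟨As.map (Term.incl K'), by rwa [List.map_map], ?_⟩
  simp only [List.forall_mem_map]
  intro A hA B hB
  refine (hL.conservative (.eq A B)).1 ?_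
  by_contra hne
  exact hw ⟨A, B, hL.represents.mem_of_eq_bigOr hAs hA, hL.represents.mem_of_eq_bigOr hAs hB, hne⟩

end Languages

end UHOG

theorem proposition10p1_general {n : ℕ} [NeZero n] {N : ℕ} {K : Ty n → Type*}
    {Γ : List (Ty n)} {α : Ty n} {H : Set (Term N K Γ Ty.t)}
    {L : Term N K Γ (Ty.sym ⇒ α ⇒ Ty.t)} {W : Term N K Γ Ty.sym} {As : List (Term N K Γ α)}
    (hAs : Prov H (.eq (.app L W) (.bigOr (As.map Term.eqTo))))
    (hAs_eq : ∀ A ∈ As, ∀ B ∈ As, Prov H (.eq A B)) :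
    Prov H (.eq (.app (.app (Term.trans α) L.selfExt) W) (.app (.app (Term.trans α) L) W)) := by
  suffices h : Prov H (.eq
      (.app (.desc α) ((Term.app L W).orPred (Term.app (.desc α) (.app L W)).eqTo))
      (.app (.desc α) (.app L W))) from
    (Prov.trans_app _ _).trans ((Prov.congApp (.refl _) (.selfExt_app L W)).trans
      (h.trans (Prov.trans_app L W).symm))
  cases As with
  | nil => exact .desc_orPred_of_eq_empty hAs _
  | cons A As =>
    have hLW : Prov H (.eq (.app L W) A.eqTo) :=
      hAs.trans (.bigOr_eq (List.cons_ne_nil _ _) (List.forall_mem_map (l := A :: As).2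
        fun B hB => Prov.congEqTo (hAs_eq B hB A List.mem_cons_self)))
    exact .congApp (.refl _) (.orPred_desc_of_eq_eqTo hLW)

theorem proposition10p1 {n : ℕ} [NeZero n] {N : ℕ} {K : Ty n → Type*} {K' : Ty n → Type*}
    {α : Ty n} (Δ : Set (Term N (Plus K K') [] Ty.t))
    (L : Term N (Plus K K') [] (Ty.sym ⇒ α ⇒ Ty.t)) (𝓛 : Lang N K α)
    (hL : PseudoCanonic Δ L 𝓛) (w : List (Fin N))
    (hw : (𝓛.Valid w ∧ ¬ 𝓛.Ambiguous K' w) ∨ ¬ 𝓛.Valid w) :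
    Prov Δ (.eq (.app (.app (Term.trans α) L.selfExt) (.word w))
      (.app (.app (Term.trans α) L) (.word w))) := by
  have hamb : ¬ 𝓛.Ambiguous K' w := hw.elim And.right fun hinv ha => hinv ha.valid
  obtain ⟨As, hAs, hAs_eq⟩ := hL.exists_eq_bigOr_of_not_ambiguous hamb
  exact proposition10p1_general hAs hAs_eq
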